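/- Let $\mathbb K\in\{\mathbb R,\mathbb C\}$ and $n,r,k\in\mathbb N_0$. Let $T$ be an $n$-simplex with ordered vertices $v_0,\dots,v_n$ and barycentric coordinates $\lambda_0,\dots,\lambda_n$. For a strictly increasing $\rho:\{0,\dots,k\}\to\{0,\dots,n\}$ the Whitney form is $$\phi^T_\rho=\sum_{i=0}^k(-1)^i\lambda_{\rho(i)}\,d\lambda_{\rho(0)}\wedge\dots\wedge\widehat{d\lambda_{\rho(i)}}\wedge\dots\wedge d\lambda_{\rho(k)} .$$ Let $\mathbb K\mathcal P_r^-\Lambda^k(T)$ be the $\mathbb K$-linear span of the forms $\lambda_T^\alpha\phi^T_\rho$ with $\alpha$ a multiindex on $\{0,\dots,n\}$, $|\alpha|=r-1$, and $\rho$ as above, and let $\mathbb K\mathring{\mathcal P}_r^-\Lambda^k(T)$ be the span of those $\lambda_T^\alpha\phi^T_\rho$ for which in addition $\{i:\alpha(i)>0\}\cup\operatorname{im}\rho=\{0,\dots,n\}$ (for $r=0$ these spaces are zero). The same definitions apply to every subsimplex $F\subseteq T$, that is, the convex hull of a non-empty set of vertices of $T$, in the induced order. If $F$ is an $m$-dimensional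 subsimplex and $\imath:\{0,\dots,m\}\to\{0,\dots,n\}$ is the inclusion of its vertices, then $\operatorname{ext}^{r,k,-}_{F,T}:\mathbb K\mathring{\mathcal P}_r^-\Lambda^k(F)\to\mathbb K\mathcal P_r^-\Lambda^k(T)$ is the (unique, well-defined) $\mathbb K$-linear map with $\operatorname{ext}^{r,k,-}_{F,T}(\lambda_F^\alpha\phi^F_\rho)=\lambda_T^{\tilde\alpha}\phi^T_{\imath\circ\rho}$ for all $\lambda_F^\alpha\phi^F_\rho$ in the above spanning set, where $\tilde\alpha$ is the extension of $\alpha$ by zero along $\imath$. For a permutation $\pi$ of $\{0,\dots,n\}$ let $S_\pi$ be the affine automorphism of $T$ with $S_\pi(v_i)=v_{\pi^{-1}(i)}$; it restricts to an affine isomorphism $F\to S_\pi F$, and $S_\pi^*$ denotes the pullback. A finite set $\mathcal Q=\{\omega_1,\dots,\omega_M\}$ of $k$-forms on a simplex is $\mathbb K$-invariant if for every affine automorphism $S$ of that simplex there are a permutation $\tau$ of $\{1,\dots,M\}$ and non-zero $\chi_1,\dots,\chi_M\in\mathbb K$ with $S^*\omega_i=\chi_i\omega_{\tau(i)}$ for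 all $i$. **Theorem.** For each subsimplex $F\subseteq T$ let $\mathcal Q(F)$ be a $\mathbb K$-invariant basis of $\mathbb K\mathring{\mathcal P}_r^-\Lambda^k(F)$, and suppose that for all subsimplices $F\subseteq T$ and all permutations $\pi$ of $\{0,\dots,n\}$ the sets $S_\pi^*\mathcal Q(S_\pi F)$ and $\mathcal Q(F)$ are equal up to multiplying their elements by non-zero scalars in $\mathbb K$. Then $$\bigcup_{F\subseteq T}\operatorname{ext}^{r,k,-}_{F,T}\,\mathcal Q(F)$$ is a $\mathbb K$-invariant basis of $\mathbb K\mathcal P_r^-\Lambda^k(T)$. -/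

import Mathlib

/-! Finite element differential forms on a simplex: barycentric coordinates, Whitney forms,
the spaces of the trimmed family with and without boundary conditions, simplicial symmetries,
and the extension operators. -/

namespace FiniteElementForms

section Definitions

variable {V P : Type*} [AddCommGroup V] [Module ℝ V] [AddTorsor V P]

/-- The affine hull of a simplex. -/
abbrev Hull {n : ℕ} (T : Affine.Simplex ℝ P n) : AffineSubspace ℝ P :=
  affineSpan ℝ (Set.range T.points)

/-- The tangent space of a simplex: the direction of its affine hull. -/
abbrev Tangent {n : ℕ} (T : Affine.Simplex ℝ P n) : Submodule ℝ V := (Hull T).direction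

/-- The fields of alternating `k`-linear forms on the tangent space over a (closed) simplex `T`,
with values in `𝕜`; this is the ambient space of the (real or complexified) differential
`k`-forms on `T`. All the polynomial spaces below are subspaces of it. -/
abbrev Form (𝕜 : Type*) [RCLike 𝕜] (k : ℕ) {n : ℕ} (T : Affine.Simplex ℝ P n) : Type _ :=
  T.closedInterior → (Tangent T) [⋀^Fin k]→ₗ[ℝ] 𝕜

/-- The vertices of a simplex as an affine basis of its affine hull. -/
noncomputable def vertexBasis {n : ℕ} (T : Affine.Simplex ℝ P n) :
    AffineBasis (Fin (n + 1)) ℝ (Hull T) where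
  toFun := (T.restrict (Hull T) le_rfl).points
  ind' := (T.restrict (Hull T) le_rfl).independent
  tot' := by
    have h := affineSpan_coe_preimage_eq_top (k := ℝ) (Set.range T.points)
    convert h using 2
    ext x
    constructor
    · rintro ⟨i, rfl⟩
      exact ⟨i, rfl⟩
    · rintro ⟨i, hi⟩
      exact ⟨i, Subtype.ext hi⟩

/-- A point of a simplex as a point of the affine hull. -/
def toHull {n : ℕ} {T : Affine.Simplex ℝ P n} (x : T.closedInterior) : Hull T :=
  ⟨x, T.closedInterior_subset_affineSpan x.2⟩

/-- The barycentric coordinate `λ_i`, an affine function on the affine hull. -/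
noncomputable def bary {n : ℕ} (T : Affine.Simplex ℝ P n) (i : Fin (n + 1)) :
    Hull T →ᵃ[ℝ] ℝ :=
  (vertexBasis T).coord i

/-- The exterior derivative `dλ_i` of a barycentric coordinate: a constant `1`-form, namely the
linear part of the affine function `λ_i`. -/
noncomputable def dbary {n : ℕ} (T : Affine.Simplex ℝ P n) (i : Fin (n + 1)) :
    Tangent T →ₗ[ℝ] ℝ :=
  (bary T i).linear

/-- The barycentric polynomial `λ^α`. -/
noncomputable def baryMonomial {n : ℕ} (T : Affine.Simplex ℝ P n) (α : Fin (n + 1) → ℕ)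
    (x : T.closedInterior) : ℝ :=
  ∏ i, bary T i (toHull x) ^ α i

/-- The barycentric alternator `dλ_{σ(1)} ∧ ⋯ ∧ dλ_{σ(k)}`, whose value at `v_1, …, v_k` is
`det (dλ_{σ(i)} (v_j))`. -/
noncomputable def alternator {n k : ℕ} (T : Affine.Simplex ℝ P n) (σ : Fin k → Fin (n + 1)) :
    (Tangent T) [⋀^Fin k]→ₗ[ℝ] ℝ :=
  (Matrix.detRowAlternating (n := Fin k) (R := ℝ)).compLinearMap
    (LinearMap.pi fun i => dbary T (σ i))

/-- The Whitney form
`φ_ρ = ∑ i, (-1)^i λ_{ρ(i)} dλ_{ρ(0)} ∧ ⋯ ∧ (omit dλ_{ρ(i)}) ∧ ⋯ ∧ dλ_{ρ(k)}`. -/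
noncomputable def whitney {n k : ℕ} (T : Affine.Simplex ℝ P n) (ρ : Fin (k + 1) → Fin (n + 1))
    (x : T.closedInterior) : (Tangent T) [⋀^Fin k]→ₗ[ℝ] ℝ :=
  ∑ i : Fin (k + 1),
    ((-1) ^ (i : ℕ) * bary T (ρ i) (toHull x)) • alternator T (ρ ∘ i.succAbove)

/-- The form `λ^α φ_ρ`, regarded as a form with values in `𝕜`. -/
noncomputable def monomialWhitney (𝕜 : Type*) [RCLike 𝕜] {n k : ℕ} (T : Affine.Simplex ℝ P n)
    (α : Fin (n + 1) → ℕ) (ρ : Fin (k + 1) → Fin (n + 1)) : Form 𝕜 k T :=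
  fun x => (Algebra.linearMap ℝ 𝕜).compAlternatingMap (baryMonomial T α x • whitney T ρ x)

/-- The index set of the canonical spanning set of the trimmed space of degree `r`: pairs of a
multiindex `α` on `{0, …, n}` with `|α| = r - 1` and a strictly increasing map
`ρ : {0, …, k} → {0, …, n}`. (For `r = 0` there are none.) -/
def trimmedIndex (r k n : ℕ) : Set ((Fin (n + 1) → ℕ) × (Fin (k + 1) ↪o Fin (n + 1))) :=
  {p | (∑ i, p.1 i) + 1 = r}

/-- The index set of the canonical spanning set of the trimmed space with boundary conditions:
in addition `[α] ∪ [ρ] = {0, …, n}`. -/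
def trimmedIndexBdry (r k n : ℕ) : Set ((Fin (n + 1) → ℕ) × (Fin (k + 1) ↪o Fin (n + 1))) :=
  {p | (∑ i, p.1 i) + 1 = r ∧ {i | 0 < p.1 i} ∪ Set.range p.2 = Set.univ}

/-- The space `𝒫_r^- Λ^k (T)` over `𝕜`. -/
noncomputable def trimmed (𝕜 : Type*) [RCLike 𝕜] (r k : ℕ) {n : ℕ} (T : Affine.Simplex ℝ P n) :
    Submodule 𝕜 (Form 𝕜 k T) :=
  Submodule.span 𝕜 ((fun p => monomialWhitney 𝕜 T p.1 p.2) '' trimmedIndex r k n)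

/-- The space `𝒫̊_r^- Λ^k (T)` over `𝕜` (with homogeneous boundary conditions). -/
noncomputable def trimmedBdry (𝕜 : Type*) [RCLike 𝕜] (r k : ℕ) {n : ℕ}
    (T : Affine.Simplex ℝ P n) : Submodule 𝕜 (Form 𝕜 k T) :=
  Submodule.span 𝕜 ((fun p => monomialWhitney 𝕜 T p.1 p.2) '' trimmedIndexBdry r k n)

lemma mem_closedInterior_iff {n : ℕ} (T : Affine.Simplex ℝ P n) (x : Hull T) :
    (x : P) ∈ T.closedInterior ↔ ∀ i, 0 ≤ bary T i x := by
  have hs : ∑ i, bary T i x = 1 := (vertexBasis T).sum_coord_apply_eq_one x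
  have hx : Finset.univ.affineCombination ℝ T.points (fun i => bary T i x) = (x : P) := by
    have h := (vertexBasis T).affineCombination_coord_eq_self x
    have h2 := Finset.univ.map_affineCombination (vertexBasis T) _ hs
      (AffineSubspace.subtype (Hull T))
    exact h2.symm.trans (congrArg (AffineSubspace.subtype (Hull T)) h)
  rw [← hx, Affine.Simplex.affineCombination_mem_closedInterior_iff hs]
  constructor
  · intro h i
    exact (h i).1
  · intro h i
    refine ⟨h i, ?_⟩
    rw [← hs]
    exact Finset.single_le_sum (f := fun i => bary T i x) (fun j _ => h j) (Finset.mem_univ i)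

lemma bary_nonneg {n : ℕ} (T : Affine.Simplex ℝ P n) (i : Fin (n + 1)) (x : T.closedInterior) :
    0 ≤ bary T i (toHull x) :=
  (mem_closedInterior_iff T (toHull x)).1 x.2 i

/-- For `n`-simplices `T`, `T'` and a permutation `π` of `{0, …, n}`: the affine isomorphism
`S_π` between the affine hulls with `S_π (v_i) = v'_{π⁻¹ i}`. -/
noncomputable def simplexMap {n : ℕ} (T T' : Affine.Simplex ℝ P n)
    (π : Equiv.Perm (Fin (n + 1))) : Hull T →ᵃ[ℝ] Hull T' :=
  (Finset.univ.affineCombination ℝ (fun i => vertexBasis T' (π⁻¹ i))).comp (vertexBasis T).coords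

lemma simplexMap_vertex {n : ℕ} (T T' : Affine.Simplex ℝ P n) (π : Equiv.Perm (Fin (n + 1)))
    (i : Fin (n + 1)) :
    simplexMap T T' π (vertexBasis T i) = vertexBasis T' (π⁻¹ i) := by
  simp only [simplexMap, AffineMap.comp_apply]
  refine Finset.univ.affineCombination_of_eq_one_of_eq_zero _ _ (Finset.mem_univ i) ?_ ?_
  · simp
  · intro j _ hj
    simp [hj]

lemma bary_simplexMap {n : ℕ} (T T' : Affine.Simplex ℝ P n) (π : Equiv.Perm (Fin (n + 1)))
    (i : Fin (n + 1)) (x : Hull T) :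
    bary T' i (simplexMap T T' π x) = bary T (π i) x := by
  have h : (bary T' i).comp (simplexMap T T' π) = bary T (π i) := by
    refine AffineMap.ext_on (vertexBasis T).tot ?_
    rintro _ ⟨j, rfl⟩
    rw [AffineMap.comp_apply, simplexMap_vertex]
    simp only [bary, AffineBasis.coord_apply]
    refine if_congr ?_ rfl rfl
    rw [Equiv.Perm.eq_inv_iff_eq]
  rw [← h]
  rfl

/-- The restriction of `S_π` to a map from the simplex `T` to the simplex `T'`. -/
noncomputable def simplexMapPoint {n : ℕ} (T T' : Affine.Simplex ℝ P n)
    (π : Equiv.Perm (Fin (n + 1))) (x : T.closedInterior) : T'.closedInterior :=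
  ⟨simplexMap T T' π (toHull x), by
    rw [mem_closedInterior_iff]
    intro i
    rw [bary_simplexMap]
    exact bary_nonneg T _ x⟩

/-- The pullback `S_π^*` of forms on `T'` to forms on `T`. -/
noncomputable def pullback {𝕜 : Type*} [RCLike 𝕜] {k n : ℕ} (T T' : Affine.Simplex ℝ P n)
    (π : Equiv.Perm (Fin (n + 1))) : Form 𝕜 k T' →ₗ[𝕜] Form 𝕜 k T where
  toFun ω := fun x => (ω (simplexMapPoint T T' π x)).compLinearMap (simplexMap T T' π).linear
  map_add' _ _ := rfl
  map_smul' _ _ := rfl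

/-- A set `Q` of forms on `T` is `𝕜`-invariant if it is finite and every simplicial symmetry of
`T` permutes the elements of `Q` up to nonzero factors in `𝕜`. -/
def IsInvariant {𝕜 : Type*} [RCLike 𝕜] {k n : ℕ} {T : Affine.Simplex ℝ P n}
    (Q : Set (Form 𝕜 k T)) : Prop :=
  Q.Finite ∧ ∀ π : Equiv.Perm (Fin (n + 1)), ∃ (τ : Equiv.Perm Q) (χ : Q → 𝕜),
    ∀ ω : Q, χ ω ≠ 0 ∧ pullback T T π (ω : Form 𝕜 k T) = χ ω • (τ ω : Form 𝕜 k T)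

/-- The set `Q` is a basis of the subspace `W`. -/
def IsBasisOf {𝕜 : Type*} [RCLike 𝕜] {E : Type*} [AddCommGroup E] [Module 𝕜 E] (Q : Set E)
    (W : Submodule 𝕜 E) : Prop :=
  LinearIndepOn 𝕜 id Q ∧ Submodule.span 𝕜 Q = W

/-- The sets `A` and `B` are equal up to multiplying their elements by nonzero scalars. -/
def EqUpToScaling (𝕜 : Type*) [RCLike 𝕜] {E : Type*} [AddCommGroup E] [Module 𝕜 E]
    (A B : Set E) : Prop :=
  (∀ a ∈ A, ∃ b ∈ B, ∃ c : 𝕜, c ≠ 0 ∧ a = c • b) ∧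
    ∀ b ∈ B, ∃ a ∈ A, ∃ c : 𝕜, c ≠ 0 ∧ b = c • a

/-- The `m`-dimensional subsimplices of an `n`-simplex, given by their sets of `m + 1` vertices. -/
abbrev Subsimplex (n m : ℕ) : Type := {s : Finset (Fin (n + 1)) // s.card = m + 1}

/-- The inclusion `ι(F,T) : {0, …, m} → {0, …, n}` of the (ordered) vertices. -/
def Subsimplex.incl {n m : ℕ} (F : Subsimplex n m) : Fin (m + 1) ↪o Fin (n + 1) :=
  F.1.orderEmbOfFin F.2

/-- The subsimplex as a simplex, with vertices in the order inherited from `T`. -/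
def Subsimplex.on {n m : ℕ} (F : Subsimplex n m) (T : Affine.Simplex ℝ P n) :
    Affine.Simplex ℝ P m :=
  T.face F.2

/-- The subsimplex `S_π F`; its vertices are the points `S_π (v_i) = v_{π⁻¹ i}` for the vertices
`v_i` of `F`. -/
def Subsimplex.image {n m : ℕ} (F : Subsimplex n m) (π : Equiv.Perm (Fin (n + 1))) :
    Subsimplex n m :=
  ⟨F.1.map (π⁻¹).toEmbedding, by rw [Finset.card_map, F.2]⟩

/-- The permutation of `{0, …, m}` that describes the restriction `S_π : F → S_π F` with respect
to the ordered vertices of `F` and `S_π F`. -/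
noncomputable def Subsimplex.inducedPerm {n m : ℕ} (F : Subsimplex n m)
    (π : Equiv.Perm (Fin (n + 1))) : Equiv.Perm (Fin (m + 1)) :=
  ((F.image π).1.orderIsoOfFin (F.image π).2).toEquiv.trans
    ((π.subtypeEquiv (p := (· ∈ (F.image π).1)) (q := (· ∈ F.1)) (by
      intro a
      simp only [Subsimplex.image, Finset.mem_map_equiv]
      rfl)).trans
    (F.1.orderIsoOfFin F.2).symm.toEquiv)

lemma Subsimplex.incl_inducedPerm {n m : ℕ} (F : Subsimplex n m) (π : Equiv.Perm (Fin (n + 1)))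
    (j : Fin (m + 1)) : F.incl (F.inducedPerm π j) = π ((F.image π).incl j) := by
  simp only [Subsimplex.incl, Subsimplex.inducedPerm, ← Finset.coe_orderIsoOfFin_apply]
  simp

/-- The pullback `S_π^*` of forms on `S_π F` to forms on `F`. -/
noncomputable def facePullback {𝕜 : Type*} [RCLike 𝕜] {k n m : ℕ} (T : Affine.Simplex ℝ P n)
    (F : Subsimplex n m) (π : Equiv.Perm (Fin (n + 1))) :
    Form 𝕜 k ((F.image π).on T) →ₗ[𝕜] Form 𝕜 k (F.on T) :=
  pullback (F.on T) ((F.image π).on T) (F.inducedPerm π)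

/-- The affine hull of a subsimplex lies in the affine hull of the simplex. -/
lemma hull_on_le {n m : ℕ} (T : Affine.Simplex ℝ P n) (F : Subsimplex n m) :
    Hull (F.on T) ≤ Hull T :=
  T.affineSpan_face_le F.2

lemma vertexBasis_coe {n : ℕ} (T : Affine.Simplex ℝ P n) (i : Fin (n + 1)) :
    (vertexBasis T i : P) = T.points i := rfl

/-- The map `F → S_π F` used in `facePullback` is the restriction of `S_π : T → T`. -/
lemma simplexMap_restrict {n m : ℕ} (T : Affine.Simplex ℝ P n) (F : Subsimplex n m)
    (π : Equiv.Perm (Fin (n + 1))) (x : Hull (F.on T)) :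
    (simplexMap (F.on T) ((F.image π).on T) (F.inducedPerm π) x : P) =
      simplexMap T T π (AffineSubspace.inclusion (hull_on_le T F) x) := by
  have h : (AffineSubspace.subtype (Hull ((F.image π).on T))).comp
      (simplexMap (F.on T) ((F.image π).on T) (F.inducedPerm π)) =
      (AffineSubspace.subtype (Hull T)).comp ((simplexMap T T π).comp
        (AffineSubspace.inclusion (hull_on_le T F))) := by
    refine AffineMap.ext_on (vertexBasis (F.on T)).tot ?_
    rintro _ ⟨j, rfl⟩
    have e : AffineSubspace.inclusion (hull_on_le T F) (vertexBasis (F.on T) j) =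
        vertexBasis T (F.incl j) := Subtype.ext rfl
    simp only [AffineMap.comp_apply, e, simplexMap_vertex]
    change ((F.image π).on T).points _ = T.points _
    change T.points ((F.image π).incl _) = _
    congr 1
    rw [Equiv.Perm.eq_inv_iff_eq, ← F.incl_inducedPerm]
    simp
  exact DFunLike.congr_fun h x

/-- Extension by zero `α̃` of a multiindex along the inclusion of the vertices. -/
noncomputable def Subsimplex.extendIndex {n m : ℕ} (F : Subsimplex n m) (α : Fin (m + 1) → ℕ) :
    Fin (n + 1) → ℕ :=
  Function.extend F.incl α 0

/-- Membership of the extension by zero in the index set of the trimmed space on `T`. -/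
lemma Subsimplex.extend_mem {r k n m : ℕ} (F : Subsimplex n m)
    (p : (Fin (m + 1) → ℕ) × (Fin (k + 1) ↪o Fin (m + 1))) (hp : p ∈ trimmedIndexBdry r k m) :
    (F.extendIndex p.1, p.2.trans F.incl) ∈ trimmedIndex r k n := by
  have h : ∑ i, F.extendIndex p.1 i = ∑ j, p.1 j := by
    rw [← Finset.sum_subset (Finset.subset_univ (Finset.univ.map F.incl.toEmbedding))]
    · rw [Finset.sum_map]
      exact Finset.sum_congr rfl fun j _ => F.incl.injective.extend_apply _ _ j
    · intro i _ hi
      refine Function.extend_apply' _ _ _ ?_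
      rintro ⟨j, rfl⟩
      exact hi (Finset.mem_map_of_mem _ (Finset.mem_univ j))
  exact (congrArg (· + 1) h).trans hp.1

/-! The next definitions and lemmas only serve to show that the extension operator is well
defined: the operator `ω ↦ s^{r+k} p^* ω`, where `s = ∑_{i ∈ F} λ_i` and where `p` is the central
projection onto `F`, takes the prescribed values on the canonical spanning set. -/

/-- The sum of the barycentric coordinates of `T` that belong to the subsimplex `F`. -/
noncomputable def faceSum {n m : ℕ} (T : Affine.Simplex ℝ P n) (F : Subsimplex n m)
    (x : T.closedInterior) : ℝ :=
  ∑ j, bary T (F.incl j) (toHull x)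

lemma faceSum_nonneg {n m : ℕ} (T : Affine.Simplex ℝ P n) (F : Subsimplex n m)
    (x : T.closedInterior) : 0 ≤ faceSum T F x :=
  Finset.sum_nonneg fun _ _ => bary_nonneg T _ x

lemma exists_faceProj {n m : ℕ} (T : Affine.Simplex ℝ P n) (F : Subsimplex n m)
    (x : T.closedInterior) (hx : faceSum T F x ≠ 0) :
    ∃ y : (F.on T).closedInterior, ∀ j, bary (F.on T) j (toHull y) =
      bary T (F.incl j) (toHull x) / faceSum T F x := by
  set w : Fin (m + 1) → ℝ := fun j => bary T (F.incl j) (toHull x) / faceSum T F x with hw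
  have hs : ∑ j, w j = 1 := by
    rw [hw, ← Finset.sum_div]
    exact div_self hx
  have hc : ∀ j, bary (F.on T) j
      (Finset.univ.affineCombination ℝ (vertexBasis (F.on T)) w) = w j := fun j =>
    (vertexBasis (F.on T)).coord_apply_combination_of_mem (Finset.mem_univ j) hs
  refine ⟨⟨(Finset.univ.affineCombination ℝ (vertexBasis (F.on T)) w : Hull (F.on T)), ?_⟩, hc⟩
  rw [mem_closedInterior_iff]
  intro j
  rw [hc]
  exact div_nonneg (bary_nonneg T _ x) (faceSum_nonneg T F x)

lemma exists_faceProjLinear {n m : ℕ} (T : Affine.Simplex ℝ P n) (F : Subsimplex n m)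
    (x : T.closedInterior) (hx : faceSum T F x ≠ 0) :
    ∃ (L : Tangent T →ₗ[ℝ] Tangent (F.on T)) (c : Tangent T → ℝ), ∀ v j,
      dbary T (F.incl j) v = faceSum T F x * dbary (F.on T) j (L v) +
        c v * (bary T (F.incl j) (toHull x) / faceSum T F x) := by
  classical
  set s := faceSum T F x with hs
  set ds : Tangent T →ₗ[ℝ] ℝ := ∑ j, dbary T (F.incl j) with hds
  set b := vertexBasis (F.on T) with hb
  set g : Fin (m + 1) → (Tangent T →ₗ[ℝ] ℝ) := fun j =>
    s⁻¹ • dbary T (F.incl j) - (bary T (F.incl j) (toHull x) * s⁻¹ ^ 2) • ds with hg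
  have hgs : ∀ v, ∑ j, g j v = 0 := by
    intro v
    have h1 : ∑ j, bary T (F.incl j) (toHull x) = s := rfl
    simp only [hg, LinearMap.sub_apply, LinearMap.smul_apply, smul_eq_mul,
      Finset.sum_sub_distrib, ← Finset.sum_mul, ← Finset.mul_sum, h1]
    rw [hds, LinearMap.sum_apply]
    field_simp
    ring
  refine ⟨∑ j, (g j).smulRight (b j -ᵥ b 0 : Tangent (F.on T)), ds, ?_⟩
  intro v i
  have hd : ∀ j, dbary (F.on T) i (b j -ᵥ b 0 : Tangent (F.on T)) =
      (if i = j then 1 else 0) - (if i = 0 then 1 else 0) := by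
    intro j
    rw [dbary, AffineMap.linearMap_vsub, bary, vsub_eq_sub, ← hb, AffineBasis.coord_apply,
      AffineBasis.coord_apply]
  have hL : dbary (F.on T) i ((∑ j, (g j).smulRight (b j -ᵥ b 0 : Tangent (F.on T))) v) =
      g i v := by
    rw [LinearMap.sum_apply, map_sum]
    simp only [LinearMap.smulRight_apply, map_smul, hd, smul_eq_mul, mul_sub,
      Finset.sum_sub_distrib, ← Finset.sum_mul, hgs]
    simp
  rw [hL]
  simp only [hg, LinearMap.sub_apply, LinearMap.smul_apply, smul_eq_mul]
  field_simp
  ring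

/-- The Whitney form as a determinant with the values of the barycentric coordinates as first
row. -/
lemma whitney_apply {n k : ℕ} (T : Affine.Simplex ℝ P n) (ρ : Fin (k + 1) → Fin (n + 1))
    (x : T.closedInterior) (v : Fin k → Tangent T) :
    whitney T ρ x v = Matrix.det (Matrix.of (Fin.cons (fun i => bary T (ρ i) (toHull x))
      (fun j i => dbary T (ρ i) (v j)) : Fin (k + 1) → Fin (k + 1) → ℝ)) := by
  have h : whitney T ρ x v = ∑ i : Fin (k + 1),
      (((-1) ^ (i : ℕ) * bary T (ρ i) (toHull x)) • alternator T (ρ ∘ i.succAbove)) v := by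
    rw [whitney]
    induction (Finset.univ : Finset (Fin (k + 1))) using Finset.induction_on with
    | empty => simp
    | insert a t ha ih => rw [Finset.sum_insert ha, AlternatingMap.add_apply, ih,
        Finset.sum_insert ha]
  rw [Matrix.det_succ_row_zero, h]
  rfl

lemma whitney_faceProj {n m k : ℕ} (T : Affine.Simplex ℝ P n) (F : Subsimplex n m)
    (x : T.closedInterior) (y : (F.on T).closedInterior) (s : ℝ)
    (hy : ∀ j, bary T (F.incl j) (toHull x) = s * bary (F.on T) j (toHull y))
    (L : Tangent T →ₗ[ℝ] Tangent (F.on T)) (c : Tangent T → ℝ)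
    (hL : ∀ v j, dbary T (F.incl j) v = s * dbary (F.on T) j (L v) +
      c v * bary (F.on T) j (toHull y))
    (ρ : Fin (k + 1) → Fin (m + 1)) (v : Fin k → Tangent T) :
    whitney T (F.incl ∘ ρ) x v = s ^ (k + 1) * whitney (F.on T) ρ y (L ∘ v) := by
  by_cases hs : s = 0
  · rw [hs, zero_pow (Nat.succ_ne_zero k), zero_mul, whitney_apply]
    refine Matrix.det_eq_zero_of_row_eq_zero 0 ?_
    intro j
    simp [hy, hs]
  rw [whitney_apply, whitney_apply]
  have h := Matrix.det_smul (Matrix.of (Fin.cons (fun i => bary (F.on T) (ρ i) (toHull y))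
      (fun j i => dbary (F.on T) (ρ i) ((L ∘ v) j)) : Fin (k + 1) → Fin (k + 1) → ℝ)) s
  rw [Fintype.card_fin] at h
  rw [← h]
  refine Matrix.det_eq_of_forall_row_eq_smul_add_const
    (Fin.cons 0 (fun j => c (v j) / s) : Fin (k + 1) → ℝ) 0 rfl ?_
  intro i j
  refine Fin.cases ?_ (fun i => ?_) i
  · simp [hy]
  · simp only [Matrix.of_apply, Fin.cons_succ, Fin.cons_zero, Matrix.smul_apply, smul_eq_mul,
      Function.comp_apply, hL]
    field_simp

lemma baryMonomial_extend {n m : ℕ} (T : Affine.Simplex ℝ P n) (F : Subsimplex n m)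
    (x : T.closedInterior) (y : (F.on T).closedInterior) (s : ℝ)
    (hy : ∀ j, bary T (F.incl j) (toHull x) = s * bary (F.on T) j (toHull y))
    (α : Fin (m + 1) → ℕ) :
    baryMonomial T (F.extendIndex α) x = s ^ (∑ j, α j) * baryMonomial (F.on T) α y := by
  rw [baryMonomial, baryMonomial, ← Finset.prod_pow_eq_pow_sum, ← Finset.prod_mul_distrib]
  rw [← Finset.prod_subset (Finset.subset_univ (Finset.univ.map F.incl.toEmbedding))]
  · rw [Finset.prod_map]
    refine Finset.prod_congr rfl fun j _ => ?_
    change bary T (F.incl j) (toHull x) ^ F.extendIndex α (F.incl j) = _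
    rw [hy, Subsimplex.extendIndex, F.incl.injective.extend_apply, mul_pow]
  · intro i _ hi
    have : F.extendIndex α i = 0 := by
      refine Function.extend_apply' _ _ _ ?_
      rintro ⟨j, rfl⟩
      exact hi (Finset.mem_map_of_mem _ (Finset.mem_univ j))
    rw [this, pow_zero]

lemma exists_extAmbient (𝕜 : Type*) [RCLike 𝕜] (r k : ℕ) {n m : ℕ} (T : Affine.Simplex ℝ P n)
    (F : Subsimplex n m) :
    ∃ E : Form 𝕜 k (F.on T) →ₗ[𝕜] Form 𝕜 k T,
      ∀ p ∈ trimmedIndexBdry r k m, E (monomialWhitney 𝕜 (F.on T) p.1 p.2) =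
        monomialWhitney 𝕜 T (F.extendIndex p.1) (p.2.trans F.incl) := by
  classical
  have key : ∀ x : T.closedInterior, ∃ E : Form 𝕜 k (F.on T) →ₗ[𝕜]
      ((Tangent T) [⋀^Fin k]→ₗ[ℝ] 𝕜), ∀ p ∈ trimmedIndexBdry r k m,
      E (monomialWhitney 𝕜 (F.on T) p.1 p.2) =
        monomialWhitney 𝕜 T (F.extendIndex p.1) (p.2.trans F.incl) x := by
    intro x
    by_cases hx : faceSum T F x = 0
    · refine ⟨0, fun p _ => ?_⟩
      have h0 : ∀ j, bary T (F.incl j) (toHull x) = 0 := fun j =>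
        (Finset.sum_eq_zero_iff_of_nonneg (fun j _ => bary_nonneg T (F.incl j) x)).1 hx j
          (Finset.mem_univ j)
      ext v
      have hw : whitney T (F.incl ∘ p.2) x v = 0 := by
        rw [whitney_apply]
        refine Matrix.det_eq_zero_of_row_eq_zero 0 ?_
        intro j
        simp [h0]
      simp [monomialWhitney, hw]
    · obtain ⟨y, hy⟩ := exists_faceProj T F x hx
      obtain ⟨L, c, hL⟩ := exists_faceProjLinear T F x hx
      simp only [← hy] at hL
      have hy' : ∀ j, bary T (F.incl j) (toHull x) =
          faceSum T F x * bary (F.on T) j (toHull y) := by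
        intro j
        rw [hy]
        field_simp
      refine ⟨{ toFun := fun ω => ((faceSum T F x ^ (r + k) : ℝ) : 𝕜) • (ω y).compLinearMap L
                map_add' := ?_
                map_smul' := ?_ }, ?_⟩
      · intro ω η
        ext v
        simp
      · intro a ω
        ext v
        simp [mul_left_comm]
      · intro p hp
        ext v
        have h1 := baryMonomial_extend T F x y _ hy' p.1
        have h2 := whitney_faceProj T F x y _ hy' L c hL p.2 v
        have h3 : r + k = (∑ j, p.1 j) + (k + 1) := by
          have := hp.1
          omega
        have h4 : (L ∘ v : Fin k → Tangent (F.on T)) = fun i => L (v i) := rfl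
        have h5 : whitney T (p.2.trans F.incl) x v =
          faceSum T F x ^ (k + 1) * whitney (F.on T) p.2 y (L ∘ v) := h2
        simp only [LinearMap.coe_mk, AddHom.coe_mk, monomialWhitney, AlternatingMap.smul_apply,
          AlternatingMap.compLinearMap_apply, LinearMap.compAlternatingMap_apply,
          Algebra.linearMap_apply, smul_eq_mul, h1, h5, h3, h4, map_mul, map_pow, pow_add]
        simp only [RCLike.algebraMap_eq_ofReal]
        ring
  choose E hE using key
  exact ⟨LinearMap.pi E, fun p hp => funext fun x => hE x p hp⟩

/-- There is exactly one linear operator `𝒫̊_r^- Λ^k (F) → 𝒫_r^- Λ^k (T)` that maps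
`λ_F^α φ^F_ρ` to `λ_T^α̃ φ^T_ρ̃` for all members of the canonical spanning set. -/
theorem existsUnique_ext (𝕜 : Type*) [RCLike 𝕜] (r k : ℕ) {n m : ℕ} (T : Affine.Simplex ℝ P n)
    (F : Subsimplex n m) :
    ∃! E : trimmedBdry 𝕜 r k (F.on T) →ₗ[𝕜] trimmed 𝕜 r k T,
      ∀ (p : (Fin (m + 1) → ℕ) × (Fin (k + 1) ↪o Fin (m + 1)))
        (hp : p ∈ trimmedIndexBdry r k m),
        E ⟨monomialWhitney 𝕜 (F.on T) p.1 p.2, Submodule.subset_span ⟨p, hp, rfl⟩⟩ =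
          ⟨monomialWhitney 𝕜 T (F.extendIndex p.1) (p.2.trans F.incl),
            Submodule.subset_span ⟨_, F.extend_mem p hp, rfl⟩⟩ := by
  obtain ⟨E, hE⟩ := exists_extAmbient 𝕜 r k T F
  have hmap : ∀ ω ∈ trimmedBdry 𝕜 r k (F.on T), E ω ∈ trimmed 𝕜 r k T := by
    intro ω hω
    refine (Submodule.span_le (p := (trimmed 𝕜 r k T).comap E)).2 ?_ hω
    rintro _ ⟨p, hp, rfl⟩
    change E (monomialWhitney 𝕜 (F.on T) p.1 p.2) ∈ trimmed 𝕜 r k T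
    rw [hE p hp]
    exact Submodule.subset_span ⟨_, F.extend_mem p hp, rfl⟩
  refine ⟨E.restrict hmap, fun p hp => Subtype.ext (hE p hp), ?_⟩
  intro G hG
  ext ⟨ω, hω⟩ : 1
  unfold trimmedBdry at hω
  induction hω using Submodule.span_induction with
  | mem ω h =>
    obtain ⟨p, hp, rfl⟩ := h
    exact (hG p hp).trans (Subtype.ext (hE p hp).symm)
  | zero => exact (map_zero G).trans (map_zero (E.restrict hmap)).symm
  | add a b ha hb iha ihb =>
    have h1 := map_add G ⟨a, ha⟩ ⟨b, hb⟩
    have h2 := map_add (E.restrict hmap) ⟨a, ha⟩ ⟨b, hb⟩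
    rw [iha, ihb] at h1
    exact h1.trans h2.symm
  | smul c a ha iha =>
    have h1 := map_smul G c ⟨a, ha⟩
    have h2 := map_smul (E.restrict hmap) c ⟨a, ha⟩
    rw [iha] at h1
    exact h1.trans h2.symm

/-- The extension operator `ext^{r,k,-}_{F,T} : 𝒫̊_r^- Λ^k (F) → 𝒫_r^- Λ^k (T)`: the unique linear
operator with `λ_F^α φ^F_ρ ↦ λ_T^α̃ φ^T_ρ̃` on the canonical spanning set, where `α̃` extends `α`
by zero and `ρ̃ = ι(F,T) ∘ ρ`. -/
noncomputable def extOp (𝕜 : Type*) [RCLike 𝕜] (r k : ℕ) {n m : ℕ} (T : Affine.Simplex ℝ P n)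
    (F : Subsimplex n m) : trimmedBdry 𝕜 r k (F.on T) →ₗ[𝕜] trimmed 𝕜 r k T :=
  (existsUnique_ext 𝕜 r k T F).choose

/-- The set `⋃_{F ⊆ T} ext_{F,T} Q(F)` of forms on `T`. -/
def extUnion {𝕜 : Type*} [RCLike 𝕜] {k n : ℕ} (r : ℕ) (T : Affine.Simplex ℝ P n)
    (Q : ∀ (m : ℕ) (F : Subsimplex n m), Set (Form 𝕜 k (F.on T))) : Set (Form 𝕜 k T) :=
  ⋃ (m : ℕ) (F : Subsimplex n m),
    {η | ∃ ω : trimmedBdry 𝕜 r k (F.on T), (ω : Form 𝕜 k (F.on T)) ∈ Q m F ∧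
      (extOp 𝕜 r k T F ω : Form 𝕜 k T) = η}

end Definitions

end FiniteElementForms

namespace FiniteElementForms

section

variable {𝕜 : Type*} [RCLike 𝕜] {V P : Type*} [AddCommGroup V] [Module ℝ V] [AddTorsor V P]

/-! ### Whitney forms of arbitrary index maps -/

/-! The theorem rests on the geometric decomposition of `trimmed` as the direct sum of the
extensions of the spaces `trimmedBdry` of all subsimplices, together with the fact that simplicial
symmetries only permute the summands.

Spanning: `λ^α φ_ρ` is extended from the subsimplex whose vertices are the support of `α` together
with the image of `ρ` (`monomialWhitney_mem_range_extForm`). Directness: the trace onto `F` undoes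
the extension from `F` (`trace_extOp_self`) and kills the extension from every subsimplex not
contained in `F` (`trace_extOp_of_not_subset`), so the system of traces is triangular with respect
to dimension (`iSupIndep_range_extForm`). As extension is injective, bases of the summands combine
to a basis of `trimmed`.

Invariance: pulling back along `S_π` an extension from `S_π F` is the same as pulling back on the
face and then extending from `F` (`pullback_extOp`). By the compatibility of the bases, a symmetry
therefore sends each basis form to a non-zero multiple of a basis form. Linear independence makes
this assignment injective, and finiteness makes it a permutation.

A symmetry turns an increasing `ρ` into `π ∘ ρ`, which need not be increasing. Whitney forms are
therefore treated for arbitrary index maps, with signs read off from the determinant formula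
`whitney_apply`. -/

lemma monomialWhitney_apply {n k : ℕ} (T : Affine.Simplex ℝ P n) (α : Fin (n + 1) → ℕ)
    (ρ : Fin (k + 1) → Fin (n + 1)) (x : T.closedInterior) (v : Fin k → Tangent T) :
    monomialWhitney 𝕜 T α ρ x v = ((baryMonomial T α x * whitney T ρ x v : ℝ) : 𝕜) := by
  simp [monomialWhitney]

/-- In the determinant formula the entries of `ρ` label the columns, so `σ` permutes columns. -/
lemma whitney_comp_perm {n k : ℕ} (T : Affine.Simplex ℝ P n) (ρ : Fin (k + 1) → Fin (n + 1))
    (σ : Equiv.Perm (Fin (k + 1))) (x : T.closedInterior) (v : Fin k → Tangent T) :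
    whitney T (ρ ∘ σ) x v = ((Equiv.Perm.sign σ : ℤ) : ℝ) * whitney T ρ x v := by
  rw [whitney_apply, whitney_apply, ← Matrix.det_permute']
  congr 1
  ext i j
  refine Fin.cases ?_ (fun i => ?_) i <;> rfl

lemma whitney_of_not_injective {n k : ℕ} (T : Affine.Simplex ℝ P n)
    (ρ : Fin (k + 1) → Fin (n + 1)) (hρ : ¬ Function.Injective ρ) (x : T.closedInterior)
    (v : Fin k → Tangent T) : whitney T ρ x v = 0 := by
  simp only [Function.Injective, not_forall] at hρ
  obtain ⟨i, j, hij, hne⟩ := hρ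
  rw [whitney_apply]
  refine Matrix.det_zero_of_column_eq hne fun a => ?_
  refine Fin.cases ?_ (fun a => ?_) a <;> simp [hij]

lemma monomialWhitney_of_not_injective {n k : ℕ} (T : Affine.Simplex ℝ P n)
    (α : Fin (n + 1) → ℕ) (ρ : Fin (k + 1) → Fin (n + 1)) (hρ : ¬ Function.Injective ρ) :
    monomialWhitney 𝕜 T α ρ = 0 := by
  funext x
  ext v
  simp [monomialWhitney_apply, whitney_of_not_injective T ρ hρ]

lemma monomialWhitney_comp_perm {n k : ℕ} (T : Affine.Simplex ℝ P n) (α : Fin (n + 1) → ℕ)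
    (ρ : Fin (k + 1) → Fin (n + 1)) (σ : Equiv.Perm (Fin (k + 1))) :
    monomialWhitney 𝕜 T α (ρ ∘ σ) =
      ((Equiv.Perm.sign σ : ℤ) : 𝕜) • monomialWhitney 𝕜 T α ρ := by
  funext x
  ext v
  rw [Pi.smul_apply, AlternatingMap.smul_apply, monomialWhitney_apply, monomialWhitney_apply,
    whitney_comp_perm, smul_eq_mul]
  push_cast
  ring

/-- An injective map is a strictly increasing map up to a permutation of its domain. -/
lemma exists_orderEmbedding_comp_perm {n k : ℕ} (ρ : Fin (k + 1) → Fin (n + 1))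
    (hρ : Function.Injective ρ) :
    ∃ (ρ' : Fin (k + 1) ↪o Fin (n + 1)) (σ : Equiv.Perm (Fin (k + 1))), ρ = ρ' ∘ σ := by
  refine ⟨OrderEmbedding.ofStrictMono (ρ ∘ Tuple.sort ρ)
    ((Tuple.monotone_sort ρ).strictMono_of_injective (hρ.comp (Equiv.injective _))),
    (Tuple.sort ρ).symm, ?_⟩
  funext i
  simp

lemma monomialWhitney_mem_trimmedBdry {n k r : ℕ} (T : Affine.Simplex ℝ P n)
    (α : Fin (n + 1) → ℕ) (ρ : Fin (k + 1) → Fin (n + 1)) (hα : (∑ i, α i) + 1 = r)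
    (hρ : {i | 0 < α i} ∪ Set.range ρ = Set.univ) :
    monomialWhitney 𝕜 T α ρ ∈ trimmedBdry 𝕜 r k T := by
  by_cases h : Function.Injective ρ
  · obtain ⟨ρ', σ, rfl⟩ := exists_orderEmbedding_comp_perm ρ h
    rw [monomialWhitney_comp_perm]
    rw [σ.surjective.range_comp] at hρ
    exact Submodule.smul_mem _ _ (Submodule.subset_span ⟨(α, ρ'), ⟨hα, hρ⟩, rfl⟩)
  · rw [monomialWhitney_of_not_injective T α ρ h]
    exact Submodule.zero_mem _

/-- The defining property of `extOp` covers increasing `ρ` only. It persists for all maps because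
both sides acquire the same sign under a permutation of the domain and vanish for non-injective `ρ`.
-/
lemma extOp_monomialWhitney {n m k r : ℕ} (T : Affine.Simplex ℝ P n) (F : Subsimplex n m)
    (α : Fin (m + 1) → ℕ) (ρ : Fin (k + 1) → Fin (m + 1)) (hα : (∑ i, α i) + 1 = r)
    (hρ : {i | 0 < α i} ∪ Set.range ρ = Set.univ)
    (hmem : monomialWhitney 𝕜 (F.on T) α ρ ∈ trimmedBdry 𝕜 r k (F.on T)) :
    (extOp 𝕜 r k T F ⟨monomialWhitney 𝕜 (F.on T) α ρ, hmem⟩ : Form 𝕜 k T) =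
      monomialWhitney 𝕜 T (F.extendIndex α) (F.incl ∘ ρ) := by
  by_cases h : Function.Injective ρ
  · obtain ⟨ρ', σ, rfl⟩ := exists_orderEmbedding_comp_perm ρ h
    rw [σ.surjective.range_comp] at hρ
    have hp : (α, ρ') ∈ trimmedIndexBdry r k m := ⟨hα, hρ⟩
    have h1 := congrArg Subtype.val ((existsUnique_ext 𝕜 r k T F).choose_spec.1 (α, ρ') hp)
    have h2 : (⟨monomialWhitney 𝕜 (F.on T) α (ρ' ∘ σ), hmem⟩ : trimmedBdry 𝕜 r k (F.on T)) =
        ((Equiv.Perm.sign σ : ℤ) : 𝕜) •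
          ⟨monomialWhitney 𝕜 (F.on T) α ρ', Submodule.subset_span ⟨(α, ρ'), hp, rfl⟩⟩ :=
      Subtype.ext (monomialWhitney_comp_perm _ _ _ _)
    rw [h2, map_smul, Submodule.coe_smul, ← Function.comp_assoc, monomialWhitney_comp_perm]
    exact congrArg _ h1
  · have h2 : (⟨monomialWhitney 𝕜 (F.on T) α ρ, hmem⟩ : trimmedBdry 𝕜 r k (F.on T)) = 0 :=
      Subtype.ext (monomialWhitney_of_not_injective _ _ _ h)
    rw [h2, map_zero, monomialWhitney_of_not_injective]
    · rfl
    · exact fun h' => h h'.of_comp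

/-- Linear maps on `trimmedBdry` that agree on the canonical spanning set are equal. -/
lemma trimmedBdry_hom_ext {n k r : ℕ} {T : Affine.Simplex ℝ P n} {M : Type*} [AddCommGroup M]
    [Module 𝕜 M] {A B : trimmedBdry 𝕜 r k T →ₗ[𝕜] M}
    (h : ∀ (p : (Fin (n + 1) → ℕ) × (Fin (k + 1) ↪o Fin (n + 1)))
      (_ : p ∈ trimmedIndexBdry r k n)
      (hmem : monomialWhitney 𝕜 T p.1 p.2 ∈ trimmedBdry 𝕜 r k T),
      A ⟨monomialWhitney 𝕜 T p.1 p.2, hmem⟩ = B ⟨monomialWhitney 𝕜 T p.1 p.2, hmem⟩) : A = B := by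
  refine LinearMap.ext_on_range (R := 𝕜) (v := fun p : trimmedIndexBdry r k n =>
    (⟨monomialWhitney 𝕜 T p.1.1 p.1.2, Submodule.subset_span ⟨p.1, p.2, rfl⟩⟩ :
      trimmedBdry 𝕜 r k T)) ?_ fun p => h p.1 p.2 _
  -- That the generators span the subspace is checked after mapping into the ambient space of forms,
  -- where it is the definition of `trimmedBdry`.
  apply Submodule.map_injective_of_injective (trimmedBdry 𝕜 r k T).injective_subtype
  rw [Submodule.map_span, ← Set.range_comp, Submodule.map_top, Submodule.range_subtype]
  exact congrArg (Submodule.span 𝕜) (Set.image_eq_range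
    (fun p : (Fin (n + 1) → ℕ) × (Fin (k + 1) ↪o Fin (n + 1)) =>
      monomialWhitney 𝕜 T p.1 p.2) (trimmedIndexBdry r k n)).symm

/-! ### Pullbacks along simplicial symmetries -/

lemma dbary_simplexMap {n : ℕ} (T T' : Affine.Simplex ℝ P n) (π : Equiv.Perm (Fin (n + 1)))
    (i : Fin (n + 1)) (v : Tangent T) :
    dbary T' i ((simplexMap T T' π).linear v) = dbary T (π i) v := by
  have h : (bary T' i).comp (simplexMap T T' π) = bary T (π i) :=
    AffineMap.ext (bary_simplexMap T T' π i)
  rw [dbary, dbary, ← h]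
  rfl

/-- Pullback sends `λ_i` to `λ_{π i}` and `dλ_i` to `dλ_{π i}`; reindexing the product of powers
puts `π⁻¹` into the exponent. -/
lemma pullback_monomialWhitney {n k : ℕ} (T T' : Affine.Simplex ℝ P n)
    (π : Equiv.Perm (Fin (n + 1))) (α : Fin (n + 1) → ℕ) (ρ : Fin (k + 1) → Fin (n + 1)) :
    pullback T T' π (monomialWhitney 𝕜 T' α ρ) =
      monomialWhitney 𝕜 T (α ∘ ⇑π⁻¹) (π ∘ ρ) := by
  funext x
  ext v
  change monomialWhitney 𝕜 T' α ρ (simplexMapPoint T T' π x)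
    (fun i => (simplexMap T T' π).linear (v i)) = _
  have hb : ∀ i, bary T' i (toHull (simplexMapPoint T T' π x)) = bary T (π i) (toHull x) :=
    fun i => bary_simplexMap T T' π i (toHull x)
  have h1 : baryMonomial T' α (simplexMapPoint T T' π x) = baryMonomial T (α ∘ ⇑π⁻¹) x := by
    simp only [baryMonomial, hb]
    rw [← Equiv.prod_comp π fun i => bary T i (toHull x) ^ (α ∘ ⇑π⁻¹) i]
    simp
  have h2 : whitney T' ρ (simplexMapPoint T T' π x) (fun i => (simplexMap T T' π).linear (v i)) =
      whitney T (π ∘ ρ) x v := by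
    rw [whitney_apply, whitney_apply]
    simp only [hb, dbary_simplexMap, Function.comp_apply]
  rw [monomialWhitney_apply, monomialWhitney_apply, h1, h2]

lemma pullback_one {n k : ℕ} (T : Affine.Simplex ℝ P n) (ω : Form 𝕜 k T) :
    pullback T T 1 ω = ω := by
  have h : simplexMap T T 1 = AffineMap.id ℝ (Hull T) := by
    refine AffineMap.ext_on (vertexBasis T).tot ?_
    rintro _ ⟨j, rfl⟩
    rw [simplexMap_vertex]
    rfl
  funext x
  ext v
  change ω (simplexMapPoint T T 1 x) (fun i => (simplexMap T T 1).linear (v i)) = ω x v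
  have hx : simplexMapPoint T T 1 x = x := by
    apply Subtype.ext
    change ((simplexMap T T 1 (toHull x) : Hull T) : P) = x
    rw [h]
    rfl
  rw [hx, h]
  rfl

/-- Pullback reverses composition, and so does the inverse in `S_π (v_i) = v_{π⁻¹ i}`; together they
preserve the order of the factors. -/
lemma pullback_pullback {n k : ℕ} (T : Affine.Simplex ℝ P n) (π σ : Equiv.Perm (Fin (n + 1)))
    (ω : Form 𝕜 k T) : pullback T T π (pullback T T σ ω) = pullback T T (π * σ) ω := by
  have h : (simplexMap T T σ).comp (simplexMap T T π) = simplexMap T T (π * σ) := by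
    refine AffineMap.ext_on (vertexBasis T).tot ?_
    rintro _ ⟨j, rfl⟩
    rw [AffineMap.comp_apply, simplexMap_vertex, simplexMap_vertex, simplexMap_vertex,
      mul_inv_rev]
    rfl
  funext x
  ext v
  change ω (simplexMapPoint T T σ (simplexMapPoint T T π x))
    (fun i => ((simplexMap T T σ).comp (simplexMap T T π)).linear (v i)) =
    ω (simplexMapPoint T T (π * σ) x) (fun i => (simplexMap T T (π * σ)).linear (v i))
  have hx : simplexMapPoint T T σ (simplexMapPoint T T π x) = simplexMapPoint T T (π * σ) x := by
    apply Subtype.ext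
    change (((simplexMap T T σ).comp (simplexMap T T π) (toHull x) : Hull T) : P) = _
    rw [h]
    rfl
  rw [hx, h]

lemma pullback_injective {n k : ℕ} (T : Affine.Simplex ℝ P n) (π : Equiv.Perm (Fin (n + 1))) :
    Function.Injective (pullback T T π : Form 𝕜 k T →ₗ[𝕜] Form 𝕜 k T) := by
  intro ω η h
  have := congrArg (pullback T T π⁻¹) h
  rwa [pullback_pullback, pullback_pullback, inv_mul_cancel, pullback_one, pullback_one] at this

/-! ### Symmetries acting on subsimplices, and equivariance of extension -/

lemma bdryIndex_comp_perm {n k r : ℕ} (π : Equiv.Perm (Fin (n + 1))) (α : Fin (n + 1) → ℕ)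
    (ρ : Fin (k + 1) → Fin (n + 1)) (hα : (∑ i, α i) + 1 = r)
    (hρ : {i | 0 < α i} ∪ Set.range ρ = Set.univ) :
    (∑ i, (α ∘ ⇑π⁻¹) i) + 1 = r ∧ {i | 0 < (α ∘ ⇑π⁻¹) i} ∪ Set.range (π ∘ ρ) = Set.univ := by
  refine ⟨?_, ?_⟩
  · rw [← hα]
    exact congrArg (· + 1) (Equiv.sum_comp π⁻¹ α)
  · refine Set.eq_univ_of_forall fun i => ?_
    rcases (hρ.symm ▸ Set.mem_univ (π⁻¹ i) : π⁻¹ i ∈ {i | 0 < α i} ∪ Set.range ρ) with h | ⟨j, hj⟩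
    · exact Or.inl h
    · exact Or.inr ⟨j, by simp [hj]⟩

lemma facePullback_mem {n m k r : ℕ} (T : Affine.Simplex ℝ P n) (F : Subsimplex n m)
    (π : Equiv.Perm (Fin (n + 1))) {ω : Form 𝕜 k ((F.image π).on T)}
    (hω : ω ∈ trimmedBdry 𝕜 r k ((F.image π).on T)) :
    facePullback T F π ω ∈ trimmedBdry 𝕜 r k (F.on T) := by
  refine (Submodule.span_le (p := (trimmedBdry 𝕜 r k (F.on T)).comap (facePullback T F π))).2 ?_ hω
  rintro _ ⟨p, hp, rfl⟩
  change facePullback T F π (monomialWhitney 𝕜 _ p.1 p.2) ∈ trimmedBdry 𝕜 r k (F.on T)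
  rw [facePullback, pullback_monomialWhitney]
  obtain ⟨h1, h2⟩ := bdryIndex_comp_perm (F.inducedPerm π) p.1 p.2 hp.1 hp.2
  exact monomialWhitney_mem_trimmedBdry _ _ _ h1 h2

lemma Subsimplex.extendIndex_incl {n m : ℕ} (F : Subsimplex n m) (α : Fin (m + 1) → ℕ)
    (j : Fin (m + 1)) : F.extendIndex α (F.incl j) = α j :=
  F.incl.injective.extend_apply _ _ j

lemma Subsimplex.range_incl {n m : ℕ} (F : Subsimplex n m) : Set.range F.incl = F.1 :=
  F.1.range_orderEmbOfFin F.2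

lemma Subsimplex.extendIndex_of_notMem {n m : ℕ} (F : Subsimplex n m) (α : Fin (m + 1) → ℕ)
    {i : Fin (n + 1)} (hi : i ∉ F.1) : F.extendIndex α i = 0 := by
  refine Function.extend_apply' _ _ _ fun h => hi ?_
  have : i ∈ Set.range F.incl := h
  rwa [F.range_incl] at this

lemma Subsimplex.exists_incl {n m : ℕ} (F : Subsimplex n m) {i : Fin (n + 1)} (hi : i ∈ F.1) :
    ∃ j, F.incl j = i := by
  have : i ∈ Set.range F.incl := by rwa [F.range_incl]
  exact this

lemma Subsimplex.mem_image {n m : ℕ} (F : Subsimplex n m) (π : Equiv.Perm (Fin (n + 1)))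
    (i : Fin (n + 1)) : i ∈ (F.image π).1 ↔ π i ∈ F.1 := by
  simp only [Subsimplex.image, Finset.mem_map_equiv]
  rfl

/-- On `F` this is the relation between `inducedPerm` and `π` in `incl_inducedPerm`; off `F` both
sides are zero, since `π⁻¹ i` is a vertex of `S_π F` only if `i` is one of `F`. -/
lemma Subsimplex.extendIndex_inducedPerm {n m : ℕ} (F : Subsimplex n m)
    (π : Equiv.Perm (Fin (n + 1))) (α : Fin (m + 1) → ℕ) :
    F.extendIndex (α ∘ ⇑(F.inducedPerm π)⁻¹) = (F.image π).extendIndex α ∘ ⇑π⁻¹ := by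
  funext i
  by_cases hi : i ∈ F.1
  · obtain ⟨j, rfl⟩ := F.exists_incl hi
    obtain ⟨j, rfl⟩ := (F.inducedPerm π).surjective j
    rw [F.extendIndex_incl, F.incl_inducedPerm]
    simp [Subsimplex.extendIndex_incl]
  · rw [F.extendIndex_of_notMem _ hi, Function.comp_apply, Subsimplex.extendIndex_of_notMem]
    rw [Subsimplex.mem_image]
    simpa using hi

/-- The extension operators commute with the simplicial symmetries. -/
lemma pullback_extOp {n m k r : ℕ} (T : Affine.Simplex ℝ P n) (F : Subsimplex n m)
    (π : Equiv.Perm (Fin (n + 1))) (ω : trimmedBdry 𝕜 r k ((F.image π).on T)) :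
    pullback T T π (extOp 𝕜 r k T (F.image π) ω : Form 𝕜 k T) =
      extOp 𝕜 r k T F ⟨facePullback T F π ω, facePullback_mem T F π ω.2⟩ := by
  have h : (pullback T T π) ∘ₗ (trimmed 𝕜 r k T).subtype ∘ₗ extOp 𝕜 r k T (F.image π) =
      (trimmed 𝕜 r k T).subtype ∘ₗ extOp 𝕜 r k T F ∘ₗ
        (facePullback T F π).restrict (fun _ hω => facePullback_mem T F π hω) := by
    -- On a spanning form, both sides become a Whitney form on `T`: exponents agree by
    -- `extendIndex_inducedPerm`, index maps by `incl_inducedPerm`.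
    refine trimmedBdry_hom_ext fun p hp hmem => ?_
    change pullback T T π (extOp 𝕜 r k T (F.image π)
        ⟨monomialWhitney 𝕜 ((F.image π).on T) p.1 p.2, hmem⟩ : Form 𝕜 k T) =
      extOp 𝕜 r k T F ⟨facePullback T F π (monomialWhitney 𝕜 _ p.1 p.2), _⟩
    obtain ⟨h1, h2⟩ := bdryIndex_comp_perm (F.inducedPerm π) p.1 p.2 hp.1 hp.2
    have h3 : (⟨facePullback T F π (monomialWhitney 𝕜 _ p.1 p.2), facePullback_mem T F π hmem⟩ :
        trimmedBdry 𝕜 r k (F.on T)) = ⟨_, monomialWhitney_mem_trimmedBdry _ _ _ h1 h2⟩ :=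
      Subtype.ext (pullback_monomialWhitney _ _ _ _ _)
    rw [h3, extOp_monomialWhitney _ _ _ _ h1 h2, extOp_monomialWhitney _ _ _ _ hp.1 hp.2,
      pullback_monomialWhitney, F.extendIndex_inducedPerm]
    congr 1
    funext j
    exact (F.incl_inducedPerm π (p.2 j)).symm
  exact LinearMap.congr_fun h ω

/-! ### Traces onto subsimplices -/

/-- The inclusion of the affine hull of a subsimplex. -/
def hullInclusion {n m : ℕ} (T : Affine.Simplex ℝ P n) (F : Subsimplex n m) :
    Hull (F.on T) →ᵃ[ℝ] Hull T :=
  AffineSubspace.inclusion (hull_on_le T F)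

lemma hullInclusion_vertex {n m : ℕ} (T : Affine.Simplex ℝ P n) (F : Subsimplex n m)
    (j : Fin (m + 1)) :
    hullInclusion T F (vertexBasis (F.on T) j) = vertexBasis T (F.incl j) :=
  Subtype.ext rfl

lemma bary_comp_hullInclusion {n m : ℕ} (T : Affine.Simplex ℝ P n) (F : Subsimplex n m)
    (j : Fin (m + 1)) : (bary T (F.incl j)).comp (hullInclusion T F) = bary (F.on T) j := by
  refine AffineMap.ext_on (vertexBasis (F.on T)).tot ?_
  rintro _ ⟨l, rfl⟩
  rw [AffineMap.comp_apply, hullInclusion_vertex]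
  simp only [bary, AffineBasis.coord_apply, F.incl.injective.eq_iff]

lemma bary_comp_hullInclusion_of_notMem {n m : ℕ} (T : Affine.Simplex ℝ P n)
    (F : Subsimplex n m) {i : Fin (n + 1)} (hi : i ∉ F.1) :
    (bary T i).comp (hullInclusion T F) = AffineMap.const ℝ _ 0 := by
  refine AffineMap.ext_on (vertexBasis (F.on T)).tot ?_
  rintro _ ⟨l, rfl⟩
  rw [AffineMap.comp_apply, hullInclusion_vertex]
  have : i ≠ F.incl l := by
    rintro rfl
    exact hi (F.1.orderEmbOfFin_mem F.2 l)
  simp [bary, this]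

lemma mem_closedInterior_of_face {n m : ℕ} (T : Affine.Simplex ℝ P n) (F : Subsimplex n m)
    (x : (F.on T).closedInterior) : (hullInclusion T F (toHull x) : P) ∈ T.closedInterior := by
  rw [mem_closedInterior_iff]
  intro i
  by_cases hi : i ∈ F.1
  · obtain ⟨j, rfl⟩ := F.exists_incl hi
    rw [← AffineMap.comp_apply, bary_comp_hullInclusion]
    exact bary_nonneg _ _ _
  · rw [← AffineMap.comp_apply, bary_comp_hullInclusion_of_notMem T F hi]
    exact le_rfl

/-- The inclusion of a subsimplex. -/
def facePoint {n m : ℕ} (T : Affine.Simplex ℝ P n) (F : Subsimplex n m)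
    (x : (F.on T).closedInterior) : T.closedInterior :=
  ⟨hullInclusion T F (toHull x), mem_closedInterior_of_face T F x⟩

/-- The trace of forms on `T` onto a subsimplex. -/
noncomputable def trace {k n m : ℕ} (T : Affine.Simplex ℝ P n) (F : Subsimplex n m) :
    Form 𝕜 k T →ₗ[𝕜] Form 𝕜 k (F.on T) where
  toFun ω := fun x => (ω (facePoint T F x)).compLinearMap (hullInclusion T F).linear
  map_add' _ _ := rfl
  map_smul' _ _ := rfl

lemma bary_facePoint {n m : ℕ} (T : Affine.Simplex ℝ P n) (F : Subsimplex n m)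
    (x : (F.on T).closedInterior) (j : Fin (m + 1)) :
    bary T (F.incl j) (toHull (facePoint T F x)) = bary (F.on T) j (toHull x) :=
  DFunLike.congr_fun (bary_comp_hullInclusion T F j) (toHull x)

lemma dbary_hullInclusion {n m : ℕ} (T : Affine.Simplex ℝ P n) (F : Subsimplex n m)
    (j : Fin (m + 1)) (v : Tangent (F.on T)) :
    dbary T (F.incl j) ((hullInclusion T F).linear v) = dbary (F.on T) j v := by
  rw [dbary, dbary, ← bary_comp_hullInclusion]
  rfl

lemma bary_facePoint_of_notMem {n m : ℕ} (T : Affine.Simplex ℝ P n) (F : Subsimplex n m)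
    (x : (F.on T).closedInterior) {i : Fin (n + 1)} (hi : i ∉ F.1) :
    bary T i (toHull (facePoint T F x)) = 0 :=
  DFunLike.congr_fun (bary_comp_hullInclusion_of_notMem T F hi) (toHull x)

lemma dbary_hullInclusion_of_notMem {n m : ℕ} (T : Affine.Simplex ℝ P n) (F : Subsimplex n m)
    {i : Fin (n + 1)} (hi : i ∉ F.1) (v : Tangent (F.on T)) :
    dbary T i ((hullInclusion T F).linear v) = 0 := by
  change ((bary T i).comp (hullInclusion T F)).linear v = 0
  rw [bary_comp_hullInclusion_of_notMem T F hi]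
  simp

lemma trace_monomialWhitney_apply {k n m : ℕ} (T : Affine.Simplex ℝ P n) (F : Subsimplex n m)
    (α : Fin (n + 1) → ℕ) (ρ : Fin (k + 1) → Fin (n + 1)) (x : (F.on T).closedInterior)
    (v : Fin k → Tangent (F.on T)) :
    trace T F (monomialWhitney 𝕜 T α ρ) x v =
      ((baryMonomial T α (facePoint T F x) *
        whitney T ρ (facePoint T F x) (fun i => (hullInclusion T F).linear (v i)) : ℝ) : 𝕜) :=
  monomialWhitney_apply T α ρ _ _

lemma trace_monomialWhitney_incl {k n m : ℕ} (T : Affine.Simplex ℝ P n) (F : Subsimplex n m)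
    (α : Fin (m + 1) → ℕ) (ρ : Fin (k + 1) → Fin (m + 1)) :
    trace T F (monomialWhitney 𝕜 T (F.extendIndex α) (F.incl ∘ ρ)) =
      monomialWhitney 𝕜 (F.on T) α ρ := by
  funext x
  ext v
  rw [trace_monomialWhitney_apply, monomialWhitney_apply,
    -- The scaling factor is `1`: on `F` itself the barycentric coordinates of `T` and `F` agree.
    baryMonomial_extend T F _ x 1 (fun j => by rw [bary_facePoint, one_mul]), one_pow, one_mul,
    whitney_apply, whitney_apply]
  simp only [Function.comp_apply, bary_facePoint, dbary_hullInclusion]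

/-- Both `λ_i` and `dλ_i` vanish on `F` when `v_i` is not a vertex of `F`. Hence either the monomial
has a zero factor or the Whitney determinant has a zero column. -/
lemma trace_monomialWhitney_eq_zero {k n m : ℕ} (T : Affine.Simplex ℝ P n) (F : Subsimplex n m)
    (α : Fin (n + 1) → ℕ) (ρ : Fin (k + 1) → Fin (n + 1)) {i : Fin (n + 1)} (hi : i ∉ F.1)
    (h : 0 < α i ∨ i ∈ Set.range ρ) : trace T F (monomialWhitney 𝕜 T α ρ) = 0 := by
  funext x
  ext v
  rw [trace_monomialWhitney_apply]
  rcases h with h | ⟨j, rfl⟩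
  · rw [baryMonomial, Finset.prod_eq_zero (Finset.mem_univ i)]
    · simp
    · rw [bary_facePoint_of_notMem T F x hi, zero_pow h.ne']
  · rw [whitney_apply, Matrix.det_eq_zero_of_column_eq_zero j]
    · simp
    · intro a
      refine Fin.cases ?_ (fun a => ?_) a
      · exact bary_facePoint_of_notMem T F x hi
      · exact dbary_hullInclusion_of_notMem T F hi (v a)

lemma trace_extOp_self {k n m r : ℕ} (T : Affine.Simplex ℝ P n) (F : Subsimplex n m)
    (ω : trimmedBdry 𝕜 r k (F.on T)) :
    trace T F (extOp 𝕜 r k T F ω : Form 𝕜 k T) = ω := by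
  have h : trace T F ∘ₗ (trimmed 𝕜 r k T).subtype ∘ₗ extOp 𝕜 r k T F =
      (trimmedBdry 𝕜 r k (F.on T)).subtype := by
    refine trimmedBdry_hom_ext fun p hp hmem => ?_
    change trace T F (extOp 𝕜 r k T F ⟨_, hmem⟩ : Form 𝕜 k T) = monomialWhitney 𝕜 _ p.1 p.2
    rw [extOp_monomialWhitney _ _ _ _ hp.1 hp.2, trace_monomialWhitney_incl]
  exact LinearMap.congr_fun h ω

/-- This is where the condition defining `trimmedBdry` enters: every spanning form on `F` involves
every vertex of `F`, in particular one outside `G`. -/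
lemma trace_extOp_of_not_subset {k n m l r : ℕ} (T : Affine.Simplex ℝ P n)
    (F : Subsimplex n m) (G : Subsimplex n l) (hFG : ¬ F.1 ⊆ G.1)
    (ω : trimmedBdry 𝕜 r k (F.on T)) :
    trace T G (extOp 𝕜 r k T F ω : Form 𝕜 k T) = 0 := by
  obtain ⟨i, hiF, hiG⟩ := Finset.not_subset.1 hFG
  obtain ⟨j, rfl⟩ := F.exists_incl hiF
  have h : trace T G ∘ₗ (trimmed 𝕜 r k T).subtype ∘ₗ extOp 𝕜 r k T F = 0 := by
    refine trimmedBdry_hom_ext fun p hp hmem => ?_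
    change trace T G (extOp 𝕜 r k T F ⟨_, hmem⟩ : Form 𝕜 k T) = 0
    rw [extOp_monomialWhitney _ _ _ _ hp.1 hp.2]
    refine trace_monomialWhitney_eq_zero T G _ _ hiG ?_
    rcases (hp.2.symm ▸ Set.mem_univ j : j ∈ {i | 0 < p.1 i} ∪ Set.range p.2) with h | ⟨a, rfl⟩
    · left
      rwa [F.extendIndex_incl]
    · exact Or.inr ⟨a, rfl⟩
  exact LinearMap.congr_fun h ω

/-! ### The decomposition of the trimmed space -/

/-- The extension operator as a map into the space of all forms. -/
noncomputable def extForm (𝕜 : Type*) [RCLike 𝕜] (r k : ℕ) {n m : ℕ} (T : Affine.Simplex ℝ P n)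
    (F : Subsimplex n m) : trimmedBdry 𝕜 r k (F.on T) →ₗ[𝕜] Form 𝕜 k T :=
  (trimmed 𝕜 r k T).subtype ∘ₗ extOp 𝕜 r k T F

lemma extForm_injective {k n m r : ℕ} (T : Affine.Simplex ℝ P n) (F : Subsimplex n m) :
    Function.Injective (extForm 𝕜 r k T F) := by
  intro ω η h
  have := congrArg (trace T F) h
  exact Subtype.ext ((trace_extOp_self T F ω).symm.trans (this.trans (trace_extOp_self T F η)))

/-- Given a vanishing sum, apply the trace onto `F`. Terms from subsimplices of smaller dimension
are zero by induction, the other terms with `G ≠ F` have zero trace, and the trace determines the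
term of `F` itself. -/
lemma iSupIndep_range_extForm {k n : ℕ} (r : ℕ) (T : Affine.Simplex ℝ P n) :
    iSupIndep fun F : Σ m, Subsimplex n m => LinearMap.range (extForm 𝕜 r k T F.2) := by
  classical
  rw [iSupIndep_iff_finsetSum_eq_zero_imp_eq_zero]
  intro s v hv hsum
  suffices H : ∀ (N : ℕ), ∀ F ∈ s, F.1 = N → v F = 0 from fun F hF => H _ F hF rfl
  intro N
  induction N using Nat.strong_induction_on with
  | _ N ih =>
    rintro F hF rfl
    have h0 := congrArg (trace T F.2) hsum
    rw [map_sum, map_zero, Finset.sum_eq_single_of_mem F hF] at h0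
    · obtain ⟨ω, hω⟩ := hv F hF
      rw [← hω] at h0 ⊢
      have : ω = 0 := Subtype.ext ((trace_extOp_self T F.2 ω).symm.trans h0)
      rw [this, map_zero]
    · intro G hG hGF
      by_cases hlt : G.1 < F.1
      · rw [ih _ hlt G hG rfl, map_zero]
      · obtain ⟨ω, hω⟩ := hv G hG
        rw [← hω]
        -- A subsimplex contained in `F` whose dimension is not smaller must equal `F`.
        refine trace_extOp_of_not_subset T G.2 F.2 (fun hsub => hGF ?_) ω
        obtain ⟨m, F, hF'⟩ := F
        obtain ⟨l, G, hG'⟩ := G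
        simp only at hsub hlt
        have heq : G = F := Finset.eq_of_subset_of_card_le hsub (by omega)
        subst heq
        obtain rfl : l = m := by omega
        rfl

lemma monomialWhitney_mem_range_extForm {k n r : ℕ} (T : Affine.Simplex ℝ P n)
    (α : Fin (n + 1) → ℕ) (ρ : Fin (k + 1) ↪o Fin (n + 1)) (hα : (∑ i, α i) + 1 = r) :
    ∃ (m : ℕ) (F : Subsimplex n m),
      monomialWhitney 𝕜 T α ρ ∈ LinearMap.range (extForm 𝕜 r k T F) := by
  classical
  set s : Finset (Fin (n + 1)) := Finset.univ.filter fun i => 0 < α i ∨ i ∈ Set.range ρ with hs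
  -- The domain of `ρ` has `k + 1 ≥ 1` elements, so the vertex set is non-empty and does define a
  -- subsimplex.
  have hpos : 0 < s.card := Finset.card_pos.2 ⟨ρ 0, by simp [hs]⟩
  obtain ⟨m, hm⟩ : ∃ m, s.card = m + 1 := ⟨s.card - 1, by omega⟩
  let F : Subsimplex n m := ⟨s, hm⟩
  have hmem : ∀ i, i ∈ F.1 ↔ 0 < α i ∨ i ∈ Set.range ρ := by simp [F, hs]
  have hρF : ∀ a, ∃ j, F.incl j = ρ a := fun a =>
    F.exists_incl ((hmem _).2 (Or.inr ⟨a, rfl⟩))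
  choose ρ' hρ' using hρF
  have hext : F.extendIndex (α ∘ F.incl) = α := by
    funext i
    by_cases hi : i ∈ F.1
    · obtain ⟨j, rfl⟩ := F.exists_incl hi
      exact F.extendIndex_incl _ j
    · rw [F.extendIndex_of_notMem _ hi]
      rw [hmem] at hi
      omega
  have hsum : (∑ j, (α ∘ F.incl) j) + 1 = r := by
    rw [← hα, ← Finset.sum_subset (Finset.subset_univ (Finset.univ.map F.incl.toEmbedding)),
      Finset.sum_map]
    · rfl
    · intro i _ hi
      rw [← hext]
      refine F.extendIndex_of_notMem _ fun h => hi ?_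
      obtain ⟨j, rfl⟩ := F.exists_incl h
      exact Finset.mem_map_of_mem _ (Finset.mem_univ j)
  have huniv : {j | 0 < (α ∘ F.incl) j} ∪ Set.range ρ' = Set.univ := by
    refine Set.eq_univ_of_forall fun j => ?_
    rcases (hmem (F.incl j)).1 (F.1.orderEmbOfFin_mem F.2 j) with h | ⟨a, ha⟩
    · exact Or.inl h
    · exact Or.inr ⟨a, F.incl.injective ((hρ' a).trans ha)⟩
  refine ⟨m, F, ⟨_, monomialWhitney_mem_trimmedBdry (F.on T) _ ρ' hsum huniv⟩, ?_⟩
  refine (extOp_monomialWhitney T F _ ρ' hsum huniv _).trans ?_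
  rw [hext]
  congr 1
  funext a
  exact hρ' a

/-! ### Bases -/

/-- The image of a basis of `trimmedBdry` under the extension operator. -/
def extSet {k n m : ℕ} (r : ℕ) (T : Affine.Simplex ℝ P n) (F : Subsimplex n m)
    (Q : Set (Form 𝕜 k (F.on T))) : Set (Form 𝕜 k T) :=
  extForm 𝕜 r k T F '' (Subtype.val ⁻¹' Q)

/-- Gathers dimension and subsimplex into one index, as needed for independence of the family of
ranges. -/
lemma extUnion_eq {k n : ℕ} (r : ℕ) (T : Affine.Simplex ℝ P n)
    (Q : ∀ (m : ℕ) (F : Subsimplex n m), Set (Form 𝕜 k (F.on T))) :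
    extUnion r T Q = ⋃ F : Σ m, Subsimplex n m, extSet r T F.2 (Q F.1 F.2) := by
  rw [Set.iUnion_sigma]
  rfl

/-- A basis is given as a set of ambient forms, but extension is defined only on the subspace; this
lemma and the next move the basis there. -/
lemma IsBasisOf.span_preimage {E : Type*} [AddCommGroup E] [Module 𝕜 E] {Q : Set E}
    {W : Submodule 𝕜 E} (h : IsBasisOf Q W) :
    Submodule.span 𝕜 (Subtype.val ⁻¹' Q : Set W) = ⊤ := by
  apply Submodule.map_injective_of_injective W.injective_subtype
  rw [Submodule.map_span, Submodule.map_top, Submodule.range_subtype]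
  refine Eq.trans ?_ h.2
  congr 1
  refine (Subtype.image_preimage_coe (W : Set E) Q).trans (Set.inter_eq_right.2 ?_)
  rw [← h.2]
  exact Submodule.subset_span

lemma IsBasisOf.linearIndepOn_preimage {E : Type*} [AddCommGroup E] [Module 𝕜 E] {Q : Set E}
    {W : Submodule 𝕜 E} (h : IsBasisOf Q W) :
    LinearIndepOn 𝕜 id (Subtype.val ⁻¹' Q : Set W) := by
  refine LinearIndependent.of_comp W.subtype ?_
  exact LinearIndependent.comp h.1
    (fun x : (Subtype.val ⁻¹' Q : Set W) => (⟨x.1.1, x.2⟩ : Q))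
    fun a b hab => Subtype.ext (Subtype.ext (congrArg (fun q : Q => (q : E)) hab))

lemma span_extSet {k n m r : ℕ} (T : Affine.Simplex ℝ P n) (F : Subsimplex n m)
    {Q : Set (Form 𝕜 k (F.on T))} (h : IsBasisOf Q (trimmedBdry 𝕜 r k (F.on T))) :
    Submodule.span 𝕜 (extSet r T F Q) = LinearMap.range (extForm 𝕜 r k T F) := by
  rw [extSet, ← Submodule.map_span, h.span_preimage, Submodule.map_top]

lemma linearIndepOn_extSet {k n m r : ℕ} (T : Affine.Simplex ℝ P n) (F : Subsimplex n m)
    {Q : Set (Form 𝕜 k (F.on T))} (h : IsBasisOf Q (trimmedBdry 𝕜 r k (F.on T))) :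
    LinearIndepOn 𝕜 id (extSet r T F Q) :=
  LinearIndepOn.id_image (LinearIndependent.map' h.linearIndepOn_preimage (extForm 𝕜 r k T F)
    (LinearMap.ker_eq_bot.2 (extForm_injective T F)))

lemma isBasisOf_extUnion {k n r : ℕ} (T : Affine.Simplex ℝ P n)
    (Q : ∀ (m : ℕ) (F : Subsimplex n m), Set (Form 𝕜 k (F.on T)))
    (hbasis : ∀ (m : ℕ) (F : Subsimplex n m),
      IsBasisOf (Q m F) (trimmedBdry 𝕜 r k (F.on T))) :
    IsBasisOf (extUnion r T Q) (trimmed 𝕜 r k T) := by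
  have hspan : ∀ F : Σ m, Subsimplex n m, Submodule.span 𝕜 (extSet r T F.2 (Q F.1 F.2)) =
      LinearMap.range (extForm 𝕜 r k T F.2) := fun F => span_extSet T F.2 (hbasis F.1 F.2)
  rw [extUnion_eq]
  refine ⟨?_, ?_⟩
  -- Independent sets with independent spans have an independent union; it suffices to separate one
  -- span from finitely many others.
  · refine linearIndepOn_id_iUnion_finite
      (fun F => linearIndepOn_extSet T F.2 (hbasis F.1 F.2)) fun F t _ hF => ?_
    simp only [hspan]
    exact (iSupIndep_range_extForm r T).disjoint_biSup hF
  · rw [Submodule.span_iUnion]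
    simp only [hspan]
    apply le_antisymm
    · refine iSup_le fun F => ?_
      rintro _ ⟨ω, rfl⟩
      exact (extOp 𝕜 r k T F.2 ω).2
    · refine Submodule.span_le.2 ?_
      rintro _ ⟨p, hp, rfl⟩
      obtain ⟨m, F, hF⟩ := monomialWhitney_mem_range_extForm (𝕜 := 𝕜) T p.1 p.2 hp
      exact Submodule.mem_iSup_of_mem (⟨m, F⟩ : Σ m, Subsimplex n m) hF

/-- Although `m` ranges over all of `ℕ`, the vertex set determines it through its cardinality. -/
instance finite_subsimplex (n : ℕ) : Finite (Σ m, Subsimplex n m) := by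
  refine Finite.of_injective (fun F : Σ m, Subsimplex n m => F.2.1) ?_
  rintro ⟨m, F, hF⟩ ⟨l, G, hG⟩ h
  obtain rfl : F = G := h
  obtain rfl : m = l := by omega
  rfl

lemma finite_extUnion {k n : ℕ} (r : ℕ) (T : Affine.Simplex ℝ P n)
    (Q : ∀ (m : ℕ) (F : Subsimplex n m), Set (Form 𝕜 k (F.on T)))
    (hQ : ∀ (m : ℕ) (F : Subsimplex n m), (Q m F).Finite) : (extUnion r T Q).Finite := by
  rw [extUnion_eq]
  exact Set.finite_iUnion fun F =>
    ((hQ F.1 F.2).preimage Subtype.val_injective.injOn).image _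

/-! ### Invariance -/

/-- A finite linearly independent set is invariant if every symmetry maps its elements to
non-zero multiples of its elements. -/
lemma isInvariant_of_forall_exists {k n : ℕ} {T : Affine.Simplex ℝ P n} {Q : Set (Form 𝕜 k T)}
    (hfin : Q.Finite) (hli : LinearIndepOn 𝕜 id Q)
    (h : ∀ (π : Equiv.Perm (Fin (n + 1))), ∀ ω ∈ Q, ∃ η ∈ Q, ∃ c : 𝕜, c ≠ 0 ∧
      pullback T T π ω = c • η) : IsInvariant Q := by
  refine ⟨hfin, fun π => ?_⟩
  have h' : ∀ ω : Q, ∃ (η : Q) (c : 𝕜), c ≠ 0 ∧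
      pullback T T π (ω : Form 𝕜 k T) = c • (η : Form 𝕜 k T) := by
    intro ω
    obtain ⟨η, hη, c, hc⟩ := h π ω ω.2
    exact ⟨⟨η, hη⟩, c, hc⟩
  choose τ χ hχ using h'
  have hinj : Function.Injective τ := by
    intro ω η hωη
    -- If `ω` and `η` are sent to multiples of the same element, their pullbacks are proportional,
    -- hence so are `ω` and `η`, against linear independence.
    have h1 : pullback T T π (ω : Form 𝕜 k T) =
        pullback T T π ((χ ω * (χ η)⁻¹) • (η : Form 𝕜 k T)) := by
      rw [map_smul, (hχ ω).2, (hχ η).2, hωη, smul_smul, mul_assoc,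
        inv_mul_cancel₀ (hχ η).1, mul_one]
    have h2 := pullback_injective T π h1
    by_contra hne
    have hpair : ({(ω : Form 𝕜 k T), (η : Form 𝕜 k T)} : Set (Form 𝕜 k T)) ⊆ Q :=
      Set.insert_subset ω.2 (Set.singleton_subset_iff.2 η.2)
    have h3 := (LinearIndepOn.pair_iff (R := 𝕜) id fun h => hne (Subtype.ext h)).1
      (hli.mono hpair) 1 (-(χ ω * (χ η)⁻¹))
    refine one_ne_zero (h3 ?_).1
    rw [one_smul, neg_smul, id, id, ← h2, add_neg_cancel]
  have : Finite Q := hfin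
  exact ⟨Equiv.ofBijective τ hinj.bijective_of_finite, χ, fun ω => hχ ω⟩

lemma Subsimplex.exists_image_eq {n m : ℕ} (F : Subsimplex n m) (π : Equiv.Perm (Fin (n + 1))) :
    ∃ G : Subsimplex n m, G.image π = F := by
  refine ⟨F.image π⁻¹, Subtype.ext (Finset.ext fun i => ?_)⟩
  rw [Subsimplex.mem_image, Subsimplex.mem_image]
  simp

lemma exists_pullback_eq_smul {k n r : ℕ} (T : Affine.Simplex ℝ P n)
    (Q : ∀ (m : ℕ) (F : Subsimplex n m), Set (Form 𝕜 k (F.on T)))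
    (hQ : ∀ (m : ℕ) (F : Subsimplex n m), Q m F ⊆ trimmedBdry 𝕜 r k (F.on T))
    (hsymm : ∀ (m : ℕ) (F : Subsimplex n m) (π : Equiv.Perm (Fin (n + 1))),
      EqUpToScaling 𝕜 (facePullback T F π '' Q m (F.image π)) (Q m F))
    (π : Equiv.Perm (Fin (n + 1))) (η : Form 𝕜 k T) (hη : η ∈ extUnion r T Q) :
    ∃ θ ∈ extUnion r T Q, ∃ c : 𝕜, c ≠ 0 ∧ pullback T T π η = c • θ := by
  simp only [extUnion, Set.mem_iUnion] at hη
  obtain ⟨m, F, ω, hω, rfl⟩ := hη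
  -- Pullback along `S_π` goes from `S_π G` to `G`, so the given subsimplex is written as such an
  -- image; the result is then extended from `G`.
  obtain ⟨G, rfl⟩ := F.exists_image_eq π
  obtain ⟨b, hb, c, hc, hbc⟩ := (hsymm m G π).1 _ ⟨_, hω, rfl⟩
  refine ⟨extOp 𝕜 r k T G ⟨b, hQ m G hb⟩, ?_, c, hc, ?_⟩
  · simp only [extUnion, Set.mem_iUnion]
    exact ⟨m, G, _, hb, rfl⟩
  · rw [pullback_extOp, ← Submodule.coe_smul, ← map_smul]
    congr 2
    exact Subtype.ext hbc

end

end FiniteElementForms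

theorem mainTheorem8 {𝕜 : Type*} [RCLike 𝕜] {V P : Type*} [AddCommGroup V] [Module ℝ V]
    [AddTorsor V P] (n r k : ℕ) (T : Affine.Simplex ℝ P n)
    (Q : ∀ (m : ℕ) (F : FiniteElementForms.Subsimplex n m),
      Set (FiniteElementForms.Form 𝕜 k (F.on T)))
    (hbasis : ∀ (m : ℕ) (F : FiniteElementForms.Subsimplex n m),
      FiniteElementForms.IsBasisOf (Q m F) (FiniteElementForms.trimmedBdry 𝕜 r k (F.on T)))
    (hinv : ∀ (m : ℕ) (F : FiniteElementForms.Subsimplex n m),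
      FiniteElementForms.IsInvariant (Q m F))
    (hsymm : ∀ (m : ℕ) (F : FiniteElementForms.Subsimplex n m) (π : Equiv.Perm (Fin (n + 1))),
      FiniteElementForms.EqUpToScaling 𝕜
        (FiniteElementForms.facePullback T F π '' Q m (F.image π)) (Q m F)) :
    FiniteElementForms.IsBasisOf (FiniteElementForms.extUnion r T Q)
        (FiniteElementForms.trimmed 𝕜 r k T) ∧
      FiniteElementForms.IsInvariant (FiniteElementForms.extUnion r T Q) := by
  have hB := FiniteElementForms.isBasisOf_extUnion T Q hbasis
  refine ⟨hB, FiniteElementForms.isInvariant_of_forall_exists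
    (FiniteElementForms.finite_extUnion r T Q fun m F => (hinv m F).1) hB.1 ?_⟩
  refine FiniteElementForms.exists_pullback_eq_smul T Q (fun m F => ?_) hsymm
  rw [← (hbasis m F).2]
  exact Submodule.subset_span
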